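/- Let $N,n\ge 0$ be integers and let $t_1,\dots,t_N$ be coordinates on $\mathbb R^N$. For a multi-index $I=(i_1,\dots,i_N)\in\mathbb N^N$ write $|I|=i_1+\dots+i_N$, $u_I=\partial^{|I|}u/(\partial t_1)^{i_1}\cdots(\partial t_N)^{i_N}$, let $Ii^\alpha$ be $I$ with its $i$-th entry increased by $\alpha$ (and $Ii=Ii^1$), and write $i\notin I$ if the $i$-th entry of $I$ is $0$. Let $\mathcal L=\sum_{i=1}^N L_i\,\mathrm dt_i$ be a Lagrangian one-form of order $n$, i.e. each $L_i$ is a $C^\infty$ function of $t\in\mathbb R^N$ and of the jet coordinates $u_I$, $|I|\le n$ (the dependence on $t$ may be absent). Let $$\mathrm D_i=\frac{\partial}{\partial t_i}+\sum_I u_{Ii}\frac{\partial}{\partial u_I},\qquad \frac{\delta_i L_i}{\delta u_I}=\sum_{\alpha\ge 0}(-1)^\alpha\,\mathrm D_i^\alpha\frac{\partial L_i}{\partial u_{Ii^\alpha}}.$$ Let $u:\mathbb R^N\to\mathbb R$ be $C^\infty$. For an oriented parametrized curve $S$ in $\mathbb R^N$, call $u$ critical on $S$ if $$\int_S\ \sum_{i=1}^N\Big(\sum_{|I|\le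 n}\frac{\partial L_i}{\partial u_I}[u]\,v_I\Big)\mathrm dt_i=0$$ for every $C^\infty$ function $v:\mathbb R^N\to\mathbb R$ that vanishes at the boundary of $S$ together with its partial derivatives of order at most $n-1$; here the boundary of $S$ consists of its two end points, and is empty if these coincide. Then the following are equivalent: 1. $u$ is critical on every piecewise smooth curve in $\mathbb R^N$ (a continuous map $[0,1]\to\mathbb R^N$ that is $C^\infty$ with nonvanishing derivative on each closed interval of a finite partition of $[0,1]$; the curve may be closed); 2. $u$ is critical on every smooth embedded arc in $\mathbb R^N$ (an injective $C^\infty$ map $[0,1]\to\mathbb R^N$ with nonvanishing derivative); 3. $u$ satisfies, at every point of $\mathbb R^N$, the multi-time Euler–Lagrange equations $$\frac{\delta_i L_i}{\delta u_I}=0\quad\text{for all } i \text{ and all } I\not\ni i,\qquad \frac{\delta_i L_i}{\delta u_{Ii}}=\frac{\delta_j L_j}{\delta u_{Ij}}\quad\text{for all } I \text{ and all } i\ne j.$$ -/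

import Mathlib

open scoped ContDiff

noncomputable section

namespace MultiTime

/-- Multi-time `ℝ^N`, with coordinates `t_1, …, t_N` (indexed by `Fin N`). -/
abbrev Time (N : ℕ) := Fin N → ℝ

/-- Multi-indices `I = (i_1, …, i_N)`. The condition `i ∈ I` (that is, `i_i > 0`) is
written `I i ≠ 0`, and `i ∉ I` is written `I i = 0`. -/
abbrev MultiIndex (N : ℕ) := Fin N → ℕ

/-- The order `|I| = i_1 + ⋯ + i_N`. -/
def order {N : ℕ} (I : MultiIndex N) : ℕ := ∑ k, I k

/-- The multi-index `I i^α`, obtained from `I` by adding `α` to its `i`-th entry. -/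
def incr {N : ℕ} (I : MultiIndex N) (i : Fin N) (α : ℕ) : MultiIndex N :=
  I + Pi.single i α

/-- The finite set of all multi-indices of order at most `n`. -/
def multiIndicesLE (N n : ℕ) : Finset (MultiIndex N) :=
  (Fintype.piFinset fun _ => Finset.range (n + 1)).filter fun I => order I ≤ n

theorem mem_multiIndicesLE {N n : ℕ} {I : MultiIndex N} :
    I ∈ multiIndicesLE N n ↔ order I ≤ n := by
  simp only [multiIndicesLE, Finset.mem_filter, Fintype.mem_piFinset, Finset.mem_range,
    and_iff_right_iff_imp]
  intro h k
  exact Nat.lt_succ_of_le ((Finset.single_le_sum (fun _ _ => Nat.zero_le _)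
    (Finset.mem_univ k)).trans h)

/-! ### Jet spaces and functions on them -/

/-- The `n`-th jet space of functions `ℝ^N → ℝ`: coordinates `t_i` and `u_I`, `|I| ≤ n`. -/
abbrev Jet (N n : ℕ) := Time N × (multiIndicesLE N n → ℝ)

/-- The infinite jet space: coordinates `t_i` and `u_I` for all multi-indices `I`. -/
abbrev InfJet (N : ℕ) := Time N × (MultiIndex N → ℝ)

/-- The projection of the infinite jet space onto the `n`-th jet space. -/
def trunc {N : ℕ} (n : ℕ) (z : InfJet N) : Jet N n := (z.1, fun I => z.2 I)

/-- The partial derivative `∂f/∂u_I` of a function on the infinite jet space. -/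
def partialU {N : ℕ} (I : MultiIndex N) (f : InfJet N → ℝ) (z : InfJet N) : ℝ :=
  deriv (fun s => f (z.1, Function.update z.2 I s)) (z.2 I)

/-- The partial derivative `∂f/∂t_i` of a function on the infinite jet space. -/
def partialT {N : ℕ} (i : Fin N) (f : InfJet N → ℝ) (z : InfJet N) : ℝ :=
  deriv (fun s => f (Function.update z.1 i s, z.2)) (z.1 i)

/-- The total derivative `D_i f = ∂f/∂t_i + ∑_I u_{Ii} ∂f/∂u_I`. The sum has finitely many
nonzero terms when `f` depends on finitely many coordinates only. -/
def totalDeriv {N : ℕ} (i : Fin N) (f : InfJet N → ℝ) (z : InfJet N) : ℝ :=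
  partialT i f z + ∑ᶠ I : MultiIndex N, z.2 (incr I i 1) * partialU I f z

/-- The variational derivative in the coordinate direction `i`,
`δ_i f / δu_I = ∑_{α ≥ 0} (-1)^α D_i^α (∂f/∂u_{I i^α})`. The sum has finitely many nonzero
terms when `f` depends on finitely many coordinates only. -/
def varDeriv {N : ℕ} (i : Fin N) (f : InfJet N → ℝ) (I : MultiIndex N) (z : InfJet N) : ℝ :=
  ∑ᶠ α : ℕ, (-1 : ℝ) ^ α * ((totalDeriv i)^[α] (partialU (incr I i α) f)) z

/-! ### Fields and their jets -/

/-- The partial derivative `∂f/∂t_k` of a function on multi-time. -/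
def pderiv {N : ℕ} (k : Fin N) (f : Time N → ℝ) (x : Time N) : ℝ :=
  fderiv ℝ f x (Pi.single k 1)

/-- `f_I = ∂^{|I|} f / (∂t_1)^{i_1} ⋯ (∂t_N)^{i_N}`. -/
def iterPderiv {N : ℕ} (I : MultiIndex N) (f : Time N → ℝ) : Time N → ℝ :=
  (List.finRange N).foldr (fun k g => (pderiv k)^[I k] g) f

/-- The infinite jet of the field `u` at the point `x` of multi-time. -/
def infJet {N : ℕ} (u : Time N → ℝ) (x : Time N) : InfJet N :=
  (x, fun I => iterPderiv I u x)

/-! ### Lagrangian one-forms and critical fields -/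

/-- A Lagrangian one-form `𝓛 = ∑_i L_i dt_i` of order (at most) `n` on `ℝ^N`, with smooth
coefficients `L_i` on the `n`-th jet space. -/
structure LagrangianForm (N n : ℕ) where
  coeff : Fin N → Jet N n → ℝ
  smooth : ∀ i, ContDiff ℝ ∞ (coeff i)

/-- The coefficient `L_i` as a function on the infinite jet space. -/
def LagrangianForm.lift {N n : ℕ} (L : LagrangianForm N n) (i : Fin N) : InfJet N → ℝ :=
  fun z => L.coeff i (trunc n z)

/-- The one-form `ι_{pr V} δ𝓛 = ∑_i (∑_I (∂L_i/∂u_I) v_I) dt_i` on multi-time, evaluated on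
the field `u`, for the vertical vector field `V = v ∂/∂u`, whose prolongation is
`pr V = ∑_I v_I ∂/∂u_I`. -/
def LagrangianForm.variation {N n : ℕ} (L : LagrangianForm N n) (u v : Time N → ℝ)
    (x : Time N) : Time N →L[ℝ] ℝ :=
  ∑ i, (∑ I ∈ multiIndicesLE N n, partialU I (L.lift i) (infJet u x) * iterPderiv I v x) •
    (ContinuousLinearMap.proj i : Time N →L[ℝ] ℝ)

/-- The field `u` is critical on the curve `γ`: `∫_γ ι_{pr V} δ𝓛 = 0` for every smooth
variation that vanishes at the boundary of `γ`. As usual for a Lagrangian of order `n`,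
vanishing at the boundary includes the derivatives of order at most `n - 1`. The boundary
consists of the two end points, and is empty if the curve is closed. -/
def LagrangianForm.IsCriticalOn {N n : ℕ} (L : LagrangianForm N n) (u : Time N → ℝ)
    {p q : Time N} (γ : Path p q) : Prop :=
  ∀ v : Time N → ℝ, ContDiff ℝ ∞ v →
    (p ≠ q → ∀ I : MultiIndex N, order I ≤ n - 1 →
      iterPderiv I v p = 0 ∧ iterPderiv I v q = 0) →
    curveIntegral (L.variation u v) γ = 0

/-- The path `γ` is smooth on the parameter interval `[a, b]`, including its end points, and
has nonvanishing velocity there. -/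
def IsRegularOn {N : ℕ} {p q : Time N} (γ : Path p q) (a b : ℝ) : Prop :=
  ContDiffOn ℝ ∞ γ.extend (Set.Icc a b) ∧
    ∀ s ∈ Set.Icc a b, derivWithin γ.extend (Set.Icc a b) s ≠ 0

/-- A piecewise smooth curve: away from a finite set `P` of break points, at which corners
are allowed, `γ` is a regular smooth curve (up to the ends of each piece). -/
def IsPiecewiseSmoothCurve {N : ℕ} {p q : Time N} (γ : Path p q) : Prop :=
  ∃ P : Finset ℝ, ∀ a b : ℝ, 0 ≤ a → a < b → b ≤ 1 → (∀ s ∈ P, s ∉ Set.Ioo a b) →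
    IsRegularOn γ a b

/-- A smooth embedded arc: a regular smooth curve without self-intersections. -/
def IsSmoothArc {N : ℕ} {p q : Time N} (γ : Path p q) : Prop :=
  IsRegularOn γ 0 1 ∧ Function.Injective γ

/-- The multi-time Euler–Lagrange equations for curves, on the field `u`. -/
def LagrangianForm.SatisfiesEulerLagrange {N n : ℕ} (L : LagrangianForm N n)
    (u : Time N → ℝ) : Prop :=
  (∀ (i : Fin N) (I : MultiIndex N), I i = 0 →
    ∀ x, varDeriv i (L.lift i) I (infJet u x) = 0) ∧
  (∀ (i j : Fin N), i ≠ j → ∀ (I : MultiIndex N) (x : Time N),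
    varDeriv i (L.lift i) (incr I i 1) (infJet u x) =
      varDeriv j (L.lift j) (incr I j 1) (infJet u x))

end MultiTime

end

open MultiTime

/-!
The variation of the action along a curve is the one-form `∑_i (∑_I c^i_I v_I) dt_i` on
multi-time, where `c^i_I = ∂L_i/∂u_I` is evaluated on the field `u`. Along the jet of `u` the total
derivative `D_i` is the partial derivative `∂_i` (`IsLocal.totalDeriv_infJet`), so that the
variational derivatives become functions `A^i_I` on multi-time with
`c^i_I = A^i_I + ∂_i A^i_{Ii}` (`LagrangianForm.linCoeff_eq`). Integration by parts in each
direction separately gives (`LagrangianForm.sum_linCoeff_mul`)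

  `∑_I c^i_I v_I = ∑_{I ∌ i} A^i_I v_I + ∂_i θ_i`,  `θ_i = ∑_I A^i_{Ii} v_I`.

If the Euler–Lagrange equations hold, the first sum vanishes and all `θ_i` are one function `θ`.
The variation is then the exact form `dθ`, and its integral along a piecewise smooth curve is the
difference of the values of `θ` at the end points. As `θ` involves only derivatives of `v` of order
at most `n - 1`, this is zero (`LagrangianForm.SatisfiesEulerLagrange.isCriticalOn`).

Conversely, let `u` be critical on all smooth embedded arcs; the test variations are products of
functions of one coordinate each. On a segment in the direction `i`, the derivatives `v_I` with
`i ∉ I` are independent of each other, and the fundamental lemma of the calculus of variations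
yields `A^i_I = 0` (`LagrangianForm.eulerCoeff_eq_zero_of_isCriticalOn`). On a graph
`x + (2s - 1) e_j + g(s) e_i` the integrand is then `2 ∂_jθ_j + g' ∂_iθ_i`, which differs from
`2 ∂_j(θ_j - θ_i)` by the derivative of `θ_i` along the curve. For `v` supported near `x`, the
integral of `∂_j(θ_j - θ_i)` over every such graph is therefore zero. As `g` tends to a step
function, with values off the support of `v` after the jump, this becomes `θ_j = θ_i` at `x`
(`eq_zero_of_integral_graphCurve_eq_zero`): smooth arcs imitate a curve with a corner. A variation
whose only nonzero jet coordinate at `x` is `v_I = 1` turns this into `A^j_{Ij} = A^i_{Ii}`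
(`LagrangianForm.eulerCoeff_eq_of_isCriticalOn`).
-/

namespace MultiTime

variable {N n : ℕ}

/-! ### Multi-indices -/

theorem incr_zero (I : MultiIndex N) (i : Fin N) : incr I i 0 = I := by
  simp [incr]

theorem incr_incr (I : MultiIndex N) (i : Fin N) (α β : ℕ) :
    incr (incr I i α) i β = incr I i (α + β) := by
  simp [incr, add_assoc, Pi.single_add]

theorem order_incr (I : MultiIndex N) (i : Fin N) (α : ℕ) :
    order (incr I i α) = order I + α := by
  simp [order, incr, Finset.sum_add_distrib]

theorem incr_apply_self (I : MultiIndex N) (i : Fin N) (α : ℕ) : incr I i α i = I i + α := by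
  simp [incr]

theorem incr_apply_of_ne (I : MultiIndex N) {i k : Fin N} (h : k ≠ i) (α : ℕ) :
    incr I i α k = I k := by
  simp [incr, h]

theorem incr_injective (i : Fin N) (α : ℕ) :
    Function.Injective fun I : MultiIndex N => incr I i α :=
  add_left_injective _

theorem exists_eq_incr {J : MultiIndex N} {i : Fin N} (h : J i ≠ 0) : ∃ I, J = incr I i 1 := by
  refine ⟨Function.update J i (J i - 1), funext fun k => ?_⟩
  rcases eq_or_ne k i with rfl | hk
  · rw [incr_apply_self, Function.update_self]
    omega
  · rw [incr_apply_of_ne _ hk, Function.update_of_ne hk]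

theorem multiIndex_induction {P : MultiIndex N → Prop} (zero : P 0)
    (step : ∀ I i, P I → P (incr I i 1)) (I : MultiIndex N) : P I := by
  induction hm : order I generalizing I with
  | zero =>
    have : I = 0 := funext fun k => by
      simpa using (Finset.sum_eq_zero_iff.1 hm) k (Finset.mem_univ k)
    exact this ▸ zero
  | succ m ih =>
    obtain ⟨i, hi⟩ : ∃ i, I i ≠ 0 := by
      by_contra! h
      simp [order, h] at hm
    obtain ⟨J, rfl⟩ := exists_eq_incr hi
    exact step J i (ih J (by rw [order_incr] at hm; omega))

/-! ### Iterated partial derivatives on multi-time -/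

theorem contDiff_pderiv {f : Time N → ℝ} (hf : ContDiff ℝ ∞ f) (k : Fin N) :
    ContDiff ℝ ∞ (pderiv k f) :=
  (hf.fderiv_right (m := ∞) (by simp)).clm_apply contDiff_const

theorem contDiff_pderiv_iterate {f : Time N → ℝ} (hf : ContDiff ℝ ∞ f) (k : Fin N) (m : ℕ) :
    ContDiff ℝ ∞ ((pderiv k)^[m] f) := by
  induction m with
  | zero => exact hf
  | succ m ih => rw [Function.iterate_succ_apply']; exact contDiff_pderiv ih k

theorem differentiableAt_of_contDiff {E F : Type*} [NormedAddCommGroup E] [NormedSpace ℝ E]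
    [NormedAddCommGroup F] [NormedSpace ℝ F] {f : E → F} (hf : ContDiff ℝ ∞ f) (x : E) :
    DifferentiableAt ℝ f x :=
  hf.contDiffAt.differentiableAt (by simp)

theorem pderiv_comm {f : Time N → ℝ} (hf : ContDiff ℝ ∞ f) (i k : Fin N) :
    pderiv i (pderiv k f) = pderiv k (pderiv i f) := by
  have hf' : ContDiff ℝ ∞ (fderiv ℝ f) := hf.fderiv_right (by simp)
  have key : ∀ (a b : Fin N) (x : Time N), pderiv a (pderiv b f) x =
      fderiv ℝ (fderiv ℝ f) x (Pi.single a 1) (Pi.single b 1) := by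
    intro a b x
    have h : HasFDerivAt (pderiv b f) _ x :=
      ((differentiableAt_of_contDiff hf' x).hasFDerivAt).clm_apply
        (hasFDerivAt_const (Pi.single b 1 : Time N) x)
    rw [pderiv, h.fderiv]
    simp
  funext x
  rw [key, key]
  exact (hf.contDiffAt (x := x)).isSymmSndFDerivAt
    (by rw [minSmoothness_of_isRCLikeNormedField]; exact WithTop.coe_le_coe.2 le_top) _ _

theorem pderiv_zero (k : Fin N) : pderiv k (0 : Time N → ℝ) = 0 := by
  funext x
  simp [pderiv]

theorem pderiv_iterate_zero (k : Fin N) (m : ℕ) : (pderiv k)^[m] (0 : Time N → ℝ) = 0 :=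
  Function.iterate_fixed (pderiv_zero k) m

theorem pderiv_sub {f g : Time N → ℝ} (hf : ContDiff ℝ ∞ f) (hg : ContDiff ℝ ∞ g) (k : Fin N)
    (x : Time N) : pderiv k (fun y => f y - g y) x = pderiv k f x - pderiv k g x := by
  simp only [pderiv]
  rw [fderiv_fun_sub (differentiableAt_of_contDiff hf x) (differentiableAt_of_contDiff hg x)]
  simp

theorem pderiv_sum {ι : Type*} (s : Finset ι) {f : ι → Time N → ℝ}
    (hf : ∀ a ∈ s, ContDiff ℝ ∞ (f a)) (k : Fin N) (x : Time N) :
    pderiv k (fun y => ∑ a ∈ s, f a y) x = ∑ a ∈ s, pderiv k (f a) x := by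
  simp only [pderiv]
  rw [fderiv_fun_sum fun a ha => differentiableAt_of_contDiff (hf a ha) x]
  simp

theorem pderiv_mul {f g : Time N → ℝ} (hf : ContDiff ℝ ∞ f) (hg : ContDiff ℝ ∞ g) (k : Fin N)
    (x : Time N) :
    pderiv k (fun y => f y * g y) x = pderiv k f x * g x + f x * pderiv k g x := by
  simp only [pderiv]
  rw [fderiv_fun_mul (differentiableAt_of_contDiff hf x) (differentiableAt_of_contDiff hg x)]
  simp
  ring

theorem pderiv_const_mul {f : Time N → ℝ} (hf : ContDiff ℝ ∞ f) (r : ℝ) (k : Fin N)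
    (x : Time N) : pderiv k (fun y => r * f y) x = r * pderiv k f x := by
  simp only [pderiv]
  rw [fderiv_const_mul (differentiableAt_of_contDiff hf x)]
  simp

theorem iterPderiv_zero (f : Time N → ℝ) : iterPderiv 0 f = f := by
  simp [iterPderiv]

theorem contDiff_foldr_pderiv {f : Time N → ℝ} (hf : ContDiff ℝ ∞ f) (I : MultiIndex N)
    (l : List (Fin N)) : ContDiff ℝ ∞ (l.foldr (fun k g => (pderiv k)^[I k] g) f) := by
  induction l with
  | nil => exact hf
  | cons k l ih => exact contDiff_pderiv_iterate ih k _

theorem contDiff_iterPderiv {f : Time N → ℝ} (hf : ContDiff ℝ ∞ f) (I : MultiIndex N) :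
    ContDiff ℝ ∞ (iterPderiv I f) :=
  contDiff_foldr_pderiv hf I _

theorem pderiv_iterate_comm {f : Time N → ℝ} (hf : ContDiff ℝ ∞ f) (i k : Fin N) (m : ℕ) :
    (pderiv k)^[m] (pderiv i f) = pderiv i ((pderiv k)^[m] f) := by
  induction m with
  | zero => rfl
  | succ m ih =>
    rw [Function.iterate_succ_apply', Function.iterate_succ_apply', ih,
      pderiv_comm (contDiff_pderiv_iterate hf k m)]

theorem foldr_pderiv_incr {f : Time N → ℝ} (hf : ContDiff ℝ ∞ f) (I : MultiIndex N) (i : Fin N)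
    {l : List (Fin N)} (hl : l.Nodup) (hi : i ∈ l) :
    l.foldr (fun k g => (pderiv k)^[incr I i 1 k] g) f =
      pderiv i (l.foldr (fun k g => (pderiv k)^[I k] g) f) := by
  induction l with
  | nil => simp at hi
  | cons k l ih =>
    rw [List.nodup_cons] at hl
    rw [List.foldr_cons, List.foldr_cons]
    rcases eq_or_ne k i with rfl | hk
    · have hcongr : l.foldr (fun m g => (pderiv m)^[incr I k 1 m] g) f =
          l.foldr (fun m g => (pderiv m)^[I m] g) f := by
        refine List.foldr_ext _ _ _ fun m hm g => ?_
        rw [incr_apply_of_ne I (ne_of_mem_of_not_mem hm hl.1)]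
      rw [hcongr, incr_apply_self, Function.iterate_succ_apply']
    · rw [ih hl.2 ((List.mem_cons.1 hi).resolve_left hk.symm), incr_apply_of_ne I hk,
        pderiv_iterate_comm (contDiff_foldr_pderiv hf I l)]

theorem iterPderiv_incr {f : Time N → ℝ} (hf : ContDiff ℝ ∞ f) (I : MultiIndex N) (i : Fin N) :
    iterPderiv (incr I i 1) f = pderiv i (iterPderiv I f) :=
  foldr_pderiv_incr hf I i (List.nodup_finRange N) (List.mem_finRange i)

/-- The derivatives of a product of functions of one coordinate each, as used for the test
variations: they are again such products. -/
theorem iterPderiv_prod {φ : Fin N → ℝ → ℝ} (hφ : ∀ k, ContDiff ℝ ∞ (φ k)) (J : MultiIndex N) :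
    iterPderiv J (fun x => ∏ k, φ k (x k)) = fun x => ∏ k, iteratedDeriv (J k) (φ k) (x k) := by
  have hsm : ContDiff ℝ ∞ fun x : Time N => ∏ k, φ k (x k) :=
    contDiff_prod fun k _ => (hφ k).comp (contDiff_apply ℝ ℝ k)
  induction J using multiIndex_induction with
  | zero => simp [iterPderiv_zero]
  | step I i ih =>
    rw [iterPderiv_incr hsm, ih]
    funext x
    have hd : ∀ k ∈ Finset.univ, HasFDerivAt (fun y : Time N => iteratedDeriv (I k) (φ k) (y k))
        (iteratedDeriv (I k + 1) (φ k) (x k) •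
          (ContinuousLinearMap.proj k : Time N →L[ℝ] ℝ)) x := by
      intro k _
      have h1 : HasDerivAt (iteratedDeriv (I k) (φ k)) (iteratedDeriv (I k + 1) (φ k) (x k))
          (x k) := by
        rw [iteratedDeriv_succ]
        exact (((hφ k).differentiable_iteratedDeriv (I k)
          (by exact_mod_cast WithTop.coe_lt_top _)) (x k)).hasDerivAt
      exact h1.comp_hasFDerivAt x
        (ContinuousLinearMap.proj k : Time N →L[ℝ] ℝ).hasFDerivAt
    simp only [pderiv]
    rw [(HasFDerivAt.finsetProd hd).fderiv]
    rw [sum_apply, Finset.sum_eq_single i]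
    · rw [← Finset.mul_prod_erase _ _ (Finset.mem_univ i), incr_apply_self]
      simp only [smul_apply, ContinuousLinearMap.proj_apply,
        Pi.single_eq_same, smul_eq_mul, mul_one]
      rw [mul_comm]
      congr 1
      exact Finset.prod_congr rfl fun k hk => by
        rw [incr_apply_of_ne I (Finset.ne_of_mem_erase hk)]
    · intro k _ hk
      simp [hk]
    · simp

/-! ### Local functions on the infinite jet space -/

/-- A function on the infinite jet space is local if it is a smooth function of finitely many
jet coordinates. -/
def IsLocal (f : InfJet N → ℝ) : Prop :=
  ∃ (m : ℕ) (g : Jet N m → ℝ), ContDiff ℝ ∞ g ∧ f = fun z => g (trunc m z)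

theorem LagrangianForm.isLocal_lift (L : LagrangianForm N n) (i : Fin N) :
    IsLocal (L.lift i) :=
  ⟨n, L.coeff i, L.smooth i, rfl⟩

theorem partialU_trunc {m : ℕ} {g : Jet N m → ℝ} (hg : ContDiff ℝ ∞ g)
    (I : multiIndicesLE N m) (z : InfJet N) :
    partialU I (fun z => g (trunc m z)) z = fderiv ℝ g (trunc m z) (0, Pi.single I 1) := by
  have hline : HasDerivAt (fun s : ℝ => (z.1, Function.update (trunc m z).2 I s))
      ((0 : Time N), Pi.single I (1 : ℝ)) (z.2 I) :=
    (hasDerivAt_const _ _).prodMk (hasDerivAt_update _ _ _)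
  have heq : (fun s : ℝ => g (trunc m (z.1, Function.update z.2 I s))) =
      fun s => g (z.1, Function.update (trunc m z).2 I s) := by
    funext s
    refine congrArg g (Prod.ext rfl (funext fun J => ?_))
    simp only [trunc, Function.update_apply, Subtype.ext_iff]
  have hpt : (z.1, Function.update (trunc m z).2 I (z.2 I)) = trunc m z :=
    Prod.ext rfl (Function.update_eq_self _ _)
  have hg' : HasFDerivAt g (fderiv ℝ g (trunc m z))
      (z.1, Function.update (trunc m z).2 I (z.2 I)) := by
    rw [hpt]
    exact (differentiableAt_of_contDiff hg _).hasFDerivAt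
  rw [partialU, heq]
  exact (hg'.comp_hasDerivAt _ hline).deriv

theorem partialU_trunc_of_lt {m : ℕ} (g : Jet N m → ℝ) {I : MultiIndex N} (hI : m < order I) :
    partialU I (fun z => g (trunc m z)) = 0 := by
  funext z
  have heq : (fun s : ℝ => g (trunc m (z.1, Function.update z.2 I s))) =
      fun _ => g (trunc m z) := by
    funext s
    refine congrArg g (Prod.ext rfl (funext fun J => ?_))
    have hJ := mem_multiIndicesLE.1 J.2
    have : (J : MultiIndex N) ≠ I := fun h => by rw [h] at hJ; omega
    simp [trunc, this]
  simp [partialU, heq]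

theorem partialT_trunc {m : ℕ} {g : Jet N m → ℝ} (hg : ContDiff ℝ ∞ g) (i : Fin N)
    (z : InfJet N) :
    partialT i (fun z => g (trunc m z)) z = fderiv ℝ g (trunc m z) (Pi.single i 1, 0) := by
  have hline : HasDerivAt (fun s : ℝ => (Function.update z.1 i s, (trunc m z).2))
      (Pi.single i (1 : ℝ), (0 : multiIndicesLE N m → ℝ)) (z.1 i) :=
    (hasDerivAt_update _ _ _).prodMk (hasDerivAt_const _ _)
  have hg' : HasFDerivAt g (fderiv ℝ g (trunc m z))
      (Function.update z.1 i (z.1 i), (trunc m z).2) := by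
    rw [Function.update_eq_self]
    exact (differentiableAt_of_contDiff hg _).hasFDerivAt
  exact (hg'.comp_hasDerivAt _ hline).deriv

theorem totalDeriv_trunc {m : ℕ} {g : Jet N m → ℝ} (hg : ContDiff ℝ ∞ g) (i : Fin N)
    (z : InfJet N) :
    totalDeriv i (fun z => g (trunc m z)) z =
      fderiv ℝ g (trunc m z) (Pi.single i 1, fun I => z.2 (incr I i 1)) := by
  have hsum : (∑ᶠ I : MultiIndex N, z.2 (incr I i 1) * partialU I (fun z => g (trunc m z)) z) =
      ∑ I : multiIndicesLE N m, z.2 (incr I i 1) *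
        fderiv ℝ g (trunc m z) (0, Pi.single I 1) := by
    rw [finsum_eq_sum_of_support_subset (s := multiIndicesLE N m), ← Finset.sum_coe_sort]
    · exact Finset.sum_congr rfl fun I _ => by rw [partialU_trunc hg]
    · intro I hI
      rw [Finset.mem_coe, mem_multiIndicesLE]
      by_contra! h
      exact hI (by simp [partialU_trunc_of_lt g h])
  have hvec : ((Pi.single i 1 : Time N), fun I : multiIndicesLE N m => z.2 (incr I i 1)) =
      (Pi.single i 1, 0) + ∑ I : multiIndicesLE N m,
        z.2 (incr I i 1) • ((0 : Time N), (Pi.single I 1 : multiIndicesLE N m → ℝ)) := by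
    refine Prod.ext ?_ ?_
    · simp [Prod.fst_sum]
    · funext J
      simp [Prod.snd_sum, Finset.sum_apply, Pi.single_apply]
  rw [totalDeriv, partialT_trunc hg, hsum, hvec, map_add, map_sum]
  simp only [map_smul, smul_eq_mul]

theorem IsLocal.partialU {f : InfJet N → ℝ} (hf : IsLocal f) (I : MultiIndex N) :
    IsLocal (partialU I f) := by
  obtain ⟨m, g, hg, rfl⟩ := hf
  by_cases hI : order I ≤ m
  · exact ⟨m, fun y => fderiv ℝ g y (0, Pi.single ⟨I, mem_multiIndicesLE.2 hI⟩ 1),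
      (hg.fderiv_right (m := ∞) (by simp)).clm_apply contDiff_const,
      funext fun z => partialU_trunc hg ⟨I, mem_multiIndicesLE.2 hI⟩ z⟩
  · exact ⟨m, 0, contDiff_const, partialU_trunc_of_lt g (not_le.1 hI)⟩

theorem IsLocal.totalDeriv {f : InfJet N → ℝ} (hf : IsLocal f) (i : Fin N) :
    IsLocal (totalDeriv i f) := by
  obtain ⟨m, g, hg, rfl⟩ := hf
  have hle : ∀ I : multiIndicesLE N m, (I : MultiIndex N) ∈ multiIndicesLE N (m + 1) := fun I =>
    mem_multiIndicesLE.2 ((mem_multiIndicesLE.1 I.2).trans (Nat.le_succ m))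
  have hincr : ∀ I : multiIndicesLE N m, incr I i 1 ∈ multiIndicesLE N (m + 1) := fun I => by
    rw [mem_multiIndicesLE, order_incr]
    exact Nat.succ_le_succ (mem_multiIndicesLE.1 I.2)
  refine ⟨m + 1, fun y => fderiv ℝ g (y.1, fun I => y.2 ⟨I, hle I⟩)
    (Pi.single i 1, fun I => y.2 ⟨incr I i 1, hincr I⟩), ?_, ?_⟩
  · refine ((hg.fderiv_right (m := ∞) (by simp)).comp ?_).clm_apply ?_
    · exact contDiff_fst.prodMk
        (contDiff_pi' fun I => (contDiff_apply ℝ ℝ _).comp contDiff_snd)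
    · exact contDiff_const.prodMk
        (contDiff_pi' fun I => (contDiff_apply ℝ ℝ _).comp contDiff_snd)
  · exact funext fun z => totalDeriv_trunc hg i z

theorem IsLocal.totalDeriv_iterate {f : InfJet N → ℝ} (hf : IsLocal f) (i : Fin N) (m : ℕ) :
    IsLocal ((MultiTime.totalDeriv i)^[m] f) := by
  induction m with
  | zero => exact hf
  | succ m ih => rw [Function.iterate_succ_apply']; exact ih.totalDeriv i

theorem contDiff_trunc_infJet {u : Time N → ℝ} (hu : ContDiff ℝ ∞ u) (m : ℕ) :
    ContDiff ℝ ∞ fun x => trunc m (infJet u x) :=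
  contDiff_id.prodMk (contDiff_pi' fun I => contDiff_iterPderiv hu I)

theorem IsLocal.contDiff_comp_infJet {f : InfJet N → ℝ} (hf : IsLocal f) {u : Time N → ℝ}
    (hu : ContDiff ℝ ∞ u) : ContDiff ℝ ∞ fun x => f (infJet u x) := by
  obtain ⟨m, g, hg, rfl⟩ := hf
  exact hg.comp (contDiff_trunc_infJet hu m)

/-- Along the jet of a field, the total derivative is the partial derivative on multi-time. -/
theorem IsLocal.totalDeriv_infJet {f : InfJet N → ℝ} (hf : IsLocal f) {u : Time N → ℝ}
    (hu : ContDiff ℝ ∞ u) (i : Fin N) (x : Time N) :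
    MultiTime.totalDeriv i f (infJet u x) = pderiv i (fun y => f (infJet u y)) x := by
  obtain ⟨m, g, hg, rfl⟩ := hf
  have hjet : HasFDerivAt (fun y => trunc m (infJet u y))
      ((ContinuousLinearMap.id ℝ (Time N)).prod
        (ContinuousLinearMap.pi fun I : multiIndicesLE N m =>
          fderiv ℝ (iterPderiv (I : MultiIndex N) u) x)) x :=
    (hasFDerivAt_id x).prodMk (hasFDerivAt_pi.2 fun I =>
      (differentiableAt_of_contDiff (contDiff_iterPderiv hu I) x).hasFDerivAt)
  have hcomp := (differentiableAt_of_contDiff hg (trunc m (infJet u x))).hasFDerivAt.comp x hjet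
  rw [totalDeriv_trunc hg, pderiv]
  refine Eq.trans ?_ (congrArg (fun A : Time N →L[ℝ] ℝ => A (Pi.single i 1)) hcomp.fderiv).symm
  refine congrArg (fderiv ℝ g (trunc m (infJet u x))) (Prod.ext rfl (funext fun I => ?_))
  exact congrFun (iterPderiv_incr hu I i) x

theorem IsLocal.totalDeriv_iterate_infJet {f : InfJet N → ℝ} (hf : IsLocal f) {u : Time N → ℝ}
    (hu : ContDiff ℝ ∞ u) (i : Fin N) (m : ℕ) (x : Time N) :
    ((MultiTime.totalDeriv i)^[m] f) (infJet u x) =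
      (pderiv i)^[m] (fun y => f (infJet u y)) x := by
  induction m generalizing x with
  | zero => rfl
  | succ m ih =>
    rw [Function.iterate_succ_apply', Function.iterate_succ_apply',
      (hf.totalDeriv_iterate i m).totalDeriv_infJet hu]
    exact congrArg (fun h => pderiv i h x) (funext ih)

/-! ### The coefficients of the variation -/

/-- The partial derivative `∂L_i/∂u_J`, evaluated on the field `u`. -/
noncomputable def LagrangianForm.linCoeff (L : LagrangianForm N n) (u : Time N → ℝ) (i : Fin N)
    (J : MultiIndex N) (x : Time N) : ℝ :=
  partialU J (L.lift i) (infJet u x)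

/-- The variational derivative `δ_i L_i/δu_I`, evaluated on the field `u`. -/
noncomputable def LagrangianForm.eulerCoeff (L : LagrangianForm N n) (u : Time N → ℝ) (i : Fin N)
    (I : MultiIndex N) (x : Time N) : ℝ :=
  varDeriv i (L.lift i) I (infJet u x)

section EulerCoeff

variable (L : LagrangianForm N n) {u : Time N → ℝ}

theorem LagrangianForm.contDiff_linCoeff (hu : ContDiff ℝ ∞ u) (i : Fin N) (J : MultiIndex N) :
    ContDiff ℝ ∞ (L.linCoeff u i J) :=
  ((L.isLocal_lift i).partialU J).contDiff_comp_infJet hu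

theorem LagrangianForm.linCoeff_eq_zero (u : Time N → ℝ) (i : Fin N) {J : MultiIndex N}
    (hJ : n < order J) : L.linCoeff u i J = 0 := by
  funext x
  exact congrFun (partialU_trunc_of_lt (L.coeff i) hJ) (infJet u x)

theorem LagrangianForm.eulerCoeff_eq_sum (hu : ContDiff ℝ ∞ u) (i : Fin N) (I : MultiIndex N)
    {m : ℕ} (hm : n ≤ m) : L.eulerCoeff u i I =
      fun x => ∑ α ∈ Finset.range (m + 1),
        (-1 : ℝ) ^ α * (pderiv i)^[α] (L.linCoeff u i (incr I i α)) x := by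
  funext x
  have hterm : ∀ α : ℕ,
      (-1 : ℝ) ^ α * ((totalDeriv i)^[α] (partialU (incr I i α) (L.lift i))) (infJet u x) =
        (-1 : ℝ) ^ α * (pderiv i)^[α] (L.linCoeff u i (incr I i α)) x := fun α => by
    rw [((L.isLocal_lift i).partialU _).totalDeriv_iterate_infJet hu]
    rfl
  simp only [LagrangianForm.eulerCoeff, varDeriv, hterm]
  refine finsum_eq_sum_of_support_subset _ fun α hα => ?_
  rw [Finset.mem_coe, Finset.mem_range]
  by_contra! h
  refine hα ?_
  dsimp only
  rw [L.linCoeff_eq_zero u i (by rw [order_incr]; omega), pderiv_iterate_zero]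
  simp

theorem LagrangianForm.contDiff_eulerCoeff (hu : ContDiff ℝ ∞ u) (i : Fin N)
    (I : MultiIndex N) : ContDiff ℝ ∞ (L.eulerCoeff u i I) := by
  rw [L.eulerCoeff_eq_sum hu i I le_rfl]
  exact ContDiff.sum fun α _ =>
    contDiff_const.mul (contDiff_pderiv_iterate (L.contDiff_linCoeff hu i _) i α)

theorem LagrangianForm.eulerCoeff_eq_zero (hu : ContDiff ℝ ∞ u) (i : Fin N) {I : MultiIndex N}
    (hI : n < order I) : L.eulerCoeff u i I = 0 := by
  rw [L.eulerCoeff_eq_sum hu i I le_rfl]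
  funext x
  refine Finset.sum_eq_zero fun α _ => ?_
  rw [L.linCoeff_eq_zero u i (by rw [order_incr]; omega), pderiv_iterate_zero]
  simp

/-- The recursion `∂L_i/∂u_I = δ_i L_i/δu_I + D_i (δ_i L_i/δu_{Ii})`, which is what makes
integration by parts work. -/
theorem LagrangianForm.linCoeff_eq (hu : ContDiff ℝ ∞ u) (i : Fin N) (I : MultiIndex N)
    (x : Time N) : L.linCoeff u i I x =
      L.eulerCoeff u i I x + pderiv i (L.eulerCoeff u i (incr I i 1)) x := by
  rw [L.eulerCoeff_eq_sum hu i I (Nat.le_succ n), L.eulerCoeff_eq_sum hu i (incr I i 1) le_rfl,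
    pderiv_sum _ fun α _ => contDiff_const.mul
      (contDiff_pderiv_iterate (L.contDiff_linCoeff hu i _) i α)]
  dsimp only
  rw [Finset.sum_range_succ']
  simp only [Function.iterate_zero, id, incr_zero, pow_zero, one_mul]
  rw [add_right_comm, ← Finset.sum_add_distrib, Finset.sum_eq_zero, zero_add]
  intro α _
  rw [pderiv_const_mul (contDiff_pderiv_iterate (L.contDiff_linCoeff hu i _) i α), incr_incr,
    Function.iterate_succ_apply', add_comm 1 α]
  ring

/-- The boundary term `∑_I (δ_i L_i/δu_{Ii}) v_I` left by integrating by parts in the `i`-th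
coordinate direction. -/
noncomputable def LagrangianForm.boundaryTerm (L : LagrangianForm N n) (u v : Time N → ℝ)
    (i : Fin N) (x : Time N) : ℝ :=
  ∑ I ∈ multiIndicesLE N n, L.eulerCoeff u i (incr I i 1) x * iterPderiv I v x

theorem LagrangianForm.contDiff_boundaryTerm (hu : ContDiff ℝ ∞ u) {v : Time N → ℝ}
    (hv : ContDiff ℝ ∞ v) (i : Fin N) : ContDiff ℝ ∞ (L.boundaryTerm u v i) :=
  ContDiff.sum fun I _ => (L.contDiff_eulerCoeff hu i _).mul (contDiff_iterPderiv hv I)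

theorem LagrangianForm.boundaryTerm_eq_zero {u v : Time N → ℝ} {x : Time N}
    (hv : ∀ I : MultiIndex N, iterPderiv I v x = 0) (i : Fin N) :
    L.boundaryTerm u v i x = 0 :=
  Finset.sum_eq_zero fun I _ => by rw [hv, mul_zero]

/-- Only derivatives of the variation of order at most `n - 1` enter the boundary term. -/
theorem LagrangianForm.boundaryTerm_eq_zero_of_order_le (hu : ContDiff ℝ ∞ u) {v : Time N → ℝ}
    {x : Time N} (hv : ∀ I : MultiIndex N, order I ≤ n - 1 → iterPderiv I v x = 0)
    (i : Fin N) : L.boundaryTerm u v i x = 0 := by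
  refine Finset.sum_eq_zero fun I hI => ?_
  by_cases h : order I ≤ n - 1
  · rw [hv I h, mul_zero]
  · rw [L.eulerCoeff_eq_zero hu i (by rw [order_incr]; omega)]
    simp

theorem LagrangianForm.pderiv_boundaryTerm (hu : ContDiff ℝ ∞ u) {v : Time N → ℝ}
    (hv : ContDiff ℝ ∞ v) (i k : Fin N) (x : Time N) :
    pderiv k (L.boundaryTerm u v i) x = ∑ I ∈ multiIndicesLE N n,
      (pderiv k (L.eulerCoeff u i (incr I i 1)) x * iterPderiv I v x +
        L.eulerCoeff u i (incr I i 1) x * iterPderiv (incr I k 1) v x) := by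
  unfold LagrangianForm.boundaryTerm
  rw [pderiv_sum _ fun I _ =>
    (L.contDiff_eulerCoeff hu i (incr I i 1)).mul (contDiff_iterPderiv hv I)]
  exact Finset.sum_congr rfl fun I _ => by
    rw [pderiv_mul (L.contDiff_eulerCoeff hu i _) (contDiff_iterPderiv hv I),
      iterPderiv_incr hv]

/-- Integration by parts in the `i`-th coordinate direction: up to a derivative of the boundary
term, only the jet coordinates `v_I` with `i ∉ I` enter the `i`-th component of the variation. -/
theorem LagrangianForm.sum_linCoeff_mul (hu : ContDiff ℝ ∞ u) {v : Time N → ℝ}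
    (hv : ContDiff ℝ ∞ v) (i : Fin N) (x : Time N) :
    ∑ I ∈ multiIndicesLE N n, L.linCoeff u i I x * iterPderiv I v x =
      (∑ I ∈ multiIndicesLE N n with I i = 0, L.eulerCoeff u i I x * iterPderiv I v x) +
        pderiv i (L.boundaryTerm u v i) x := by
  have hshift : ∑ I ∈ multiIndicesLE N n with ¬ I i = 0,
      L.eulerCoeff u i I x * iterPderiv I v x =
      ∑ I ∈ multiIndicesLE N n,
        L.eulerCoeff u i (incr I i 1) x * iterPderiv (incr I i 1) v x := by
    rw [← Finset.sum_filter_of_ne (s := multiIndicesLE N n) (p := fun I => order I < n)]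
    · -- The terms with `|I| = n` vanish, so that `I ↦ Ii` maps the remaining indices onto the
      -- indices of order at most `n` that contain `i`.
      symm
      refine Finset.sum_of_injOn (fun I => incr I i 1) (incr_injective i 1).injOn ?_ ?_
        fun _ _ => rfl
      · intro I hI
        simp only [Finset.coe_filter, Set.mem_ofPred_eq, mem_multiIndicesLE, order_incr,
          incr_apply_self] at hI ⊢
        omega
      · intro J hJ hJ'
        rw [Finset.mem_filter, mem_multiIndicesLE] at hJ
        obtain ⟨I, rfl⟩ := exists_eq_incr hJ.2
        refine absurd ⟨I, ?_, rfl⟩ hJ'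
        simp only [Finset.coe_filter, Set.mem_ofPred_eq, mem_multiIndicesLE]
        rw [order_incr] at hJ
        omega
    · intro I _ hI
      by_contra! h
      exact hI (by rw [L.eulerCoeff_eq_zero hu i (by rw [order_incr]; omega)]; simp)
  rw [L.pderiv_boundaryTerm hu hv, Finset.sum_add_distrib, ← hshift]
  rw [add_left_comm, Finset.sum_filter_add_sum_filter_not, ← Finset.sum_add_distrib]
  refine Finset.sum_congr rfl fun I _ => ?_
  rw [L.linCoeff_eq hu]
  ring

end EulerCoeff

/-! ### Integrals along curves -/

theorem fderiv_apply_eq_sum (f : Time N → ℝ) (x w : Time N) :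
    fderiv ℝ f x w = ∑ k, w k * pderiv k f x := by
  conv_lhs => rw [pi_eq_sum_univ' w]
  simp [pderiv]

theorem LagrangianForm.variation_apply (L : LagrangianForm N n) (u v : Time N → ℝ)
    (x w : Time N) : L.variation u v x w =
      ∑ i, w i * ∑ I ∈ multiIndicesLE N n, L.linCoeff u i I x * iterPderiv I v x := by
  simp [LagrangianForm.variation, LagrangianForm.linCoeff, mul_comm]

/-- A relation on `[0, 1]` that is transitive and holds on the intervals without break points
holds on all intervals. -/
theorem rel_of_rel_off_breaks {P : Finset ℝ} {Q : ℝ → ℝ → Prop}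
    (base : ∀ a b : ℝ, 0 ≤ a → a < b → b ≤ 1 → (∀ s ∈ P, s ∉ Set.Ioo a b) → Q a b)
    (trans : ∀ a b c, Q a b → Q b c → Q a c) {a b : ℝ} (ha : 0 ≤ a) (hab : a < b)
    (hb : b ≤ 1) : Q a b := by
  induction hm : (P.filter fun s => s ∈ Set.Ioo a b).card using Nat.strong_induction_on
    generalizing a b with
  | _ m ih =>
    by_cases h : ∀ s ∈ P, s ∉ Set.Ioo a b
    · exact base a b ha hab hb h
    · push Not at h
      obtain ⟨s, hs, hsab⟩ := h
      refine trans a s b (ih _ ?_ ha hsab.1 (hsab.2.le.trans hb) rfl)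
        (ih _ ?_ (ha.trans hsab.1.le) hsab.2 hb rfl) <;>
      · rw [← hm]
        refine Finset.card_lt_card ((Finset.ssubset_iff_of_subset fun t ht => ?_).2 ⟨s, ?_, ?_⟩)
        · rw [Finset.mem_filter] at ht ⊢
          first
          | exact ⟨ht.1, ht.2.1, ht.2.2.trans hsab.2⟩
          | exact ⟨ht.1, hsab.1.trans ht.2.1, ht.2.2⟩
        · exact Finset.mem_filter.2 ⟨hs, hsab⟩
        · simp

/-- The fundamental theorem of calculus along piecewise smooth curves. -/
theorem curveIntegral_fderiv_of_isPiecewiseSmoothCurve {f : Time N → ℝ} (hf : ContDiff ℝ ∞ f)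
    {p q : Time N} {γ : Path p q} (hγ : IsPiecewiseSmoothCurve γ) :
    curveIntegral (fderiv ℝ f) γ = f q - f p := by
  obtain ⟨P, hP⟩ := hγ
  set h : ℝ → ℝ := fun s => fderiv ℝ f (γ.extend s) (deriv γ.extend s) with hh
  have key : IntervalIntegrable h MeasureTheory.volume 0 1 ∧
      ∫ s in (0 : ℝ)..1, h s = f (γ.extend 1) - f (γ.extend 0) := by
    refine rel_of_rel_off_breaks (P := P) (Q := fun a b =>
      IntervalIntegrable h MeasureTheory.volume a b ∧
        ∫ s in a..b, h s = f (γ.extend b) - f (γ.extend a)) ?_ ?_ le_rfl one_pos le_rfl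
    · intro a b ha hab hb hs
      have hreg := (hP a b ha hab hb hs).1
      have hcont : ContinuousOn
          (fun s => fderiv ℝ f (γ.extend s) (derivWithin γ.extend (Set.Icc a b) s))
          (Set.Icc a b) :=
        ((hf.continuous_fderiv (by simp)).comp_continuousOn hreg.continuousOn).clm_apply
          (hreg.continuousOn_derivWithin (uniqueDiffOn_Icc hab) (by simp))
      have hint : IntervalIntegrable h MeasureTheory.volume a b := by
        refine (hcont.intervalIntegrable_of_Icc hab.le).congr_ae ?_
        rw [Set.uIoc_of_le hab.le, ← MeasureTheory.restrict_Ioo_eq_restrict_Ioc]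
        filter_upwards [MeasureTheory.ae_restrict_mem measurableSet_Ioo] with s hs
        rw [hh, derivWithin_of_mem_nhds (Icc_mem_nhds hs.1 hs.2)]
      refine ⟨hint, ?_⟩
      refine intervalIntegral.integral_eq_sub_of_hasDerivAt_of_le hab.le
        (hf.continuous.comp_continuousOn hreg.continuousOn) (fun s hs => ?_) hint
      have hd : DifferentiableAt ℝ γ.extend s :=
        (hreg.contDiffAt (Icc_mem_nhds hs.1 hs.2)).differentiableAt (by simp)
      exact (differentiableAt_of_contDiff hf _).hasFDerivAt.comp_hasDerivAt s hd.hasDerivAt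
    · rintro a b c ⟨h1, h2⟩ ⟨h3, h4⟩
      refine ⟨h1.trans h3, ?_⟩
      rw [← intervalIntegral.integral_add_adjacent_intervals h1 h3, h2, h4]
      ring
  rw [curveIntegral_eq_intervalIntegral_deriv, ← hh, key.2, γ.extend_one, γ.extend_zero]

theorem IsSmoothArc.isPiecewiseSmoothCurve {p q : Time N} {γ : Path p q} (hγ : IsSmoothArc γ) :
    IsPiecewiseSmoothCurve γ := by
  refine ⟨∅, fun a b ha hab hb _ => ?_⟩
  have hsub : Set.Icc a b ⊆ Set.Icc 0 1 := Set.Icc_subset_Icc ha hb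
  refine ⟨hγ.1.1.mono hsub, fun s hs => ?_⟩
  rw [derivWithin_subset hsub (uniqueDiffOn_Icc hab s hs)
    ((hγ.1.1.differentiableOn (by simp)) s (hsub hs))]
  exact hγ.1.2 s (hsub hs)

/-- The restriction to `[0, 1]` of a map from the real line to multi-time. -/
def arcPath (c : ℝ → Time N) (hc : Continuous c) : Path (c 0) (c 1) where
  toFun s := c s
  continuous_toFun := hc.comp continuous_subtype_val
  source' := by simp
  target' := by simp

theorem arcPath_extend {c : ℝ → Time N} (hc : Continuous c) {s : ℝ}
    (hs : s ∈ Set.Icc (0 : ℝ) 1) : (arcPath c hc).extend s = c s := by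
  rw [Path.extend_apply _ hs]
  rfl

theorem curveIntegral_arcPath {c : ℝ → Time N} (hc : Continuous c)
    (η : Time N → Time N →L[ℝ] ℝ) :
    curveIntegral η (arcPath c hc) = ∫ s in (0 : ℝ)..1, η (c s) (deriv c s) := by
  rw [curveIntegral_eq_intervalIntegral_deriv]
  apply intervalIntegral.integral_congr_ae_restrict
  rw [Set.uIoc_of_le zero_le_one, ← MeasureTheory.restrict_Ioo_eq_restrict_Ioc]
  filter_upwards [MeasureTheory.ae_restrict_mem measurableSet_Ioo] with s hs
  have heq : (arcPath c hc).extend =ᶠ[nhds s] c := by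
    filter_upwards [Icc_mem_nhds hs.1 hs.2] with t ht using arcPath_extend hc ht
  rw [heq.deriv_eq, heq.self_of_nhds]

/-- A smooth curve one of whose coordinates is affine and nonconstant is an embedded arc. -/
theorem isSmoothArc_arcPath {c : ℝ → Time N} (hc : ContDiff ℝ ∞ c) {j : Fin N} {a r : ℝ}
    (hr : r ≠ 0) (hj : ∀ s, c s j = a + r * s) : IsSmoothArc (arcPath c hc.continuous) := by
  have heq : Set.EqOn (arcPath c hc.continuous).extend c (Set.Icc 0 1) := fun s hs =>
    arcPath_extend hc.continuous hs
  refine ⟨⟨hc.contDiffOn.congr heq, fun s hs => ?_⟩, fun s t hst => ?_⟩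
  · rw [derivWithin_congr heq (heq hs), (differentiableAt_of_contDiff hc s).derivWithin
      (uniqueDiffOn_Icc one_pos s hs)]
    intro h0
    have h1 : HasDerivAt (fun s => c s j) (deriv c s j) s :=
      hasDerivAt_pi.1 (differentiableAt_of_contDiff hc s).hasDerivAt j
    have h2 : HasDerivAt (fun s => c s j) r s := by
      simp only [hj]
      simpa using ((hasDerivAt_id s).const_mul r).const_add a
    exact hr (by rw [h2.unique h1, h0]; rfl)
  · have h : c s j = c t j := congrFun hst j
    rw [hj, hj] at h
    exact Subtype.ext (mul_left_cancel₀ hr (add_left_cancel h))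

/-! ### Test variations -/

theorem iteratedDeriv_eq_zero_of_one_le_abs {φ : ℝ → ℝ} {a : ℝ}
    (hφ : ∀ y, 1 / 2 < |y - a| → φ y = 0) (m : ℕ) {y : ℝ} (hy : 1 ≤ |y - a|) :
    iteratedDeriv m φ y = 0 := by
  have hnear : φ =ᶠ[nhds y] fun _ => 0 := by
    have hopen : IsOpen {z : ℝ | 1 / 2 < |z - a|} :=
      isOpen_lt continuous_const (by fun_prop)
    filter_upwards [hopen.mem_nhds (show 1 / 2 < |y - a| by linarith)] with z hz using hφ z hz
  rw [hnear.iteratedDeriv_eq]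
  simp

/-- The radius `1/2` keeps all derivatives zero from distance `1` on, where the test curves
start and end. -/
theorem exists_bump (a : ℝ) : ∃ χ : ℝ → ℝ, ContDiff ℝ ∞ χ ∧ χ =ᶠ[nhds a] (fun _ => 1) ∧
    (∀ y, 0 ≤ χ y) ∧ ∀ y, 1 / 2 < |y - a| → χ y = 0 := by
  let χ : ContDiffBump a := ⟨1 / 4, 1 / 2, by norm_num, by norm_num⟩
  refine ⟨χ, χ.contDiff, χ.eventuallyEq_one, fun y => χ.nonneg, fun y hy => ?_⟩
  exact χ.zero_of_le_dist (by rw [Real.dist_eq]; exact hy.le)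

/-- A function of one variable, supported near `a`, whose only nonzero derivative at `a` is the
`l`-th. -/
theorem exists_delta_jet (a : ℝ) (l : ℕ) : ∃ φ : ℝ → ℝ, ContDiff ℝ ∞ φ ∧
    (∀ m, iteratedDeriv m φ a = if m = l then 1 else 0) ∧
    ∀ m y, 1 ≤ |y - a| → iteratedDeriv m φ y = 0 := by
  obtain ⟨χ, hχ, hχ1, -, hχ0⟩ := exists_bump a
  refine ⟨fun y => χ y * ((l.factorial : ℝ)⁻¹ * (y - a) ^ l), ?_, fun m => ?_, fun m y hy =>
    iteratedDeriv_eq_zero_of_one_le_abs (fun y hy => by rw [hχ0 y hy, zero_mul]) m hy⟩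
  · exact hχ.mul (contDiff_const.mul ((contDiff_id.sub contDiff_const).pow l))
  · have hnear : (fun y => χ y * ((l.factorial : ℝ)⁻¹ * (y - a) ^ l)) =ᶠ[nhds a]
        fun y => (l.factorial : ℝ)⁻¹ * (y - a) ^ l := by
      filter_upwards [hχ1] with y hy
      rw [hy, one_mul]
    rw [hnear.iteratedDeriv_eq, iteratedDeriv_const_mul_field,
      iteratedDeriv_comp_sub_const m (fun y : ℝ => y ^ l)]
    dsimp only
    rw [sub_self, iteratedDeriv_fun_pow_zero]
    have := Nat.factorial_ne_zero l
    aesop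

/-! ### The Euler–Lagrange equations imply criticality -/

theorem LagrangianForm.SatisfiesEulerLagrange.variation_eq_fderiv {L : LagrangianForm N n}
    {u : Time N → ℝ} (hL : L.SatisfiesEulerLagrange u) (hu : ContDiff ℝ ∞ u) {v : Time N → ℝ}
    (hv : ContDiff ℝ ∞ v) (i : Fin N) :
    L.variation u v = fderiv ℝ (L.boundaryTerm u v i) := by
  have hterm : ∀ k, L.boundaryTerm u v k = L.boundaryTerm u v i := by
    intro k
    rcases eq_or_ne k i with rfl | hk
    · rfl
    · funext x
      exact Finset.sum_congr rfl fun I _ => congrArg (· * _) (hL.2 k i hk I x)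
  funext x
  ext w
  rw [L.variation_apply, fderiv_apply_eq_sum]
  refine Finset.sum_congr rfl fun k _ => congrArg (w k * ·) ?_
  rw [L.sum_linCoeff_mul hu hv, hterm, Finset.sum_eq_zero, zero_add]
  intro I hI
  rw [show L.eulerCoeff u k I x = 0 from hL.1 k I (Finset.mem_filter.1 hI).2 x, zero_mul]

theorem LagrangianForm.SatisfiesEulerLagrange.isCriticalOn {L : LagrangianForm N n}
    {u : Time N → ℝ} (hL : L.SatisfiesEulerLagrange u) (hu : ContDiff ℝ ∞ u) {p q : Time N}
    {γ : Path p q} (hγ : IsPiecewiseSmoothCurve γ) : L.IsCriticalOn u γ := by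
  intro v hv hbd
  rcases isEmpty_or_nonempty (Fin N) with hN | ⟨⟨i⟩⟩
  · have : L.variation u v = fun _ => 0 := by
      funext x
      simp [LagrangianForm.variation]
    rw [this, curveIntegral_fun_zero]
  · rw [hL.variation_eq_fderiv hu hv i,
      curveIntegral_fderiv_of_isPiecewiseSmoothCurve (L.contDiff_boundaryTerm hu hv i) hγ]
    rcases eq_or_ne p q with rfl | hpq
    · exact sub_self _
    · rw [L.boundaryTerm_eq_zero_of_order_le hu fun I hI => (hbd hpq I hI).1,
        L.boundaryTerm_eq_zero_of_order_le hu fun I hI => (hbd hpq I hI).2, sub_self]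

/-! ### Criticality on arcs that are graphs over a coordinate line -/

/-- The curve `s ↦ x + (2s - 1) e_j + g(s) e_i`: for `i ≠ j` a graph over the `j`-th coordinate
line through `x`, for `g = 0` a segment of that line with midpoint `x`. -/
noncomputable def graphCurve (x : Time N) (j i : Fin N) (g : ℝ → ℝ) (s : ℝ) : Time N :=
  x + (2 * s - 1) • Pi.single j 1 + g s • Pi.single i 1

theorem contDiff_graphCurve (x : Time N) (j i : Fin N) {g : ℝ → ℝ} (hg : ContDiff ℝ ∞ g) :
    ContDiff ℝ ∞ (graphCurve x j i g) := by
  unfold graphCurve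
  fun_prop

theorem hasDerivAt_graphCurve (x : Time N) (j i : Fin N) {g : ℝ → ℝ} (hg : ContDiff ℝ ∞ g)
    (s : ℝ) : HasDerivAt (graphCurve x j i g)
      ((2 : ℝ) • Pi.single j 1 + deriv g s • Pi.single i 1) s := by
  have h1 : HasDerivAt (fun s : ℝ => 2 * s - 1) 2 s := by
    simpa using ((hasDerivAt_id s).const_mul 2).sub_const 1
  exact ((h1.smul_const _).const_add x).add
    ((differentiableAt_of_contDiff hg s).hasDerivAt.smul_const _)

theorem hasDerivAt_comp_graphCurve {f : Time N → ℝ} (hf : ContDiff ℝ ∞ f) (x : Time N)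
    (j i : Fin N) {g : ℝ → ℝ} (hg : ContDiff ℝ ∞ g) (s : ℝ) :
    HasDerivAt (fun s => f (graphCurve x j i g s))
      (2 * pderiv j f (graphCurve x j i g s) + deriv g s * pderiv i f (graphCurve x j i g s))
      s := by
  have h := (differentiableAt_of_contDiff hf (graphCurve x j i g s)).hasFDerivAt.comp_hasDerivAt s
    (hasDerivAt_graphCurve x j i hg s)
  simpa [pderiv] using! h

theorem graphCurve_apply_fst (x : Time N) {j i : Fin N} (hij : i ≠ j) (g : ℝ → ℝ) (s : ℝ) :
    graphCurve x j i g s j = x j + (2 * s - 1) := by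
  simp [graphCurve, hij.symm]

theorem graphCurve_apply_snd (x : Time N) {j i : Fin N} (hij : i ≠ j) (g : ℝ → ℝ) (s : ℝ) :
    graphCurve x j i g s i = x i + g s := by
  simp [graphCurve, hij]

theorem graphCurve_zero_apply_self (x : Time N) (i : Fin N) (s : ℝ) :
    graphCurve x i i 0 s i = x i + (2 * s - 1) := by
  simp [graphCurve]

theorem graphCurve_zero_apply_of_ne (x : Time N) {i k : Fin N} (hk : k ≠ i) (s : ℝ) :
    graphCurve x i i 0 s k = x k := by
  simp [graphCurve, hk]

/-- Criticality on smooth arcs, for graphs over a coordinate line and variations all of whose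
derivatives vanish at the end points. -/
theorem LagrangianForm.integral_graphCurve_eq_zero {L : LagrangianForm N n} {u : Time N → ℝ}
    (hcrit : ∀ (p q : Time N) (γ : Path p q), IsSmoothArc γ → L.IsCriticalOn u γ)
    {v : Time N → ℝ} (hv : ContDiff ℝ ∞ v) (x : Time N) {j i : Fin N} {g : ℝ → ℝ}
    (hg : ContDiff ℝ ∞ g) (hj : ∀ s, graphCurve x j i g s j = x j + (2 * s - 1))
    (h0 : ∀ I : MultiIndex N, iterPderiv I v (graphCurve x j i g 0) = 0)
    (h1 : ∀ I : MultiIndex N, iterPderiv I v (graphCurve x j i g 1) = 0) :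
    ∫ s in (0 : ℝ)..1,
      (2 * ∑ I ∈ multiIndicesLE N n, L.linCoeff u j I (graphCurve x j i g s) *
          iterPderiv I v (graphCurve x j i g s) +
        deriv g s * ∑ I ∈ multiIndicesLE N n, L.linCoeff u i I (graphCurve x j i g s) *
          iterPderiv I v (graphCurve x j i g s)) = 0 := by
  have hc := contDiff_graphCurve x j i hg
  have harc : IsSmoothArc (arcPath (graphCurve x j i g) hc.continuous) :=
    isSmoothArc_arcPath hc (j := j) (a := x j - 1) two_ne_zero fun s => by rw [hj]; ring
  have key := hcrit _ _ _ harc v hv fun _ I _ => ⟨h0 I, h1 I⟩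
  rw [curveIntegral_arcPath] at key
  refine Eq.trans ?_ key
  refine intervalIntegral.integral_congr fun s _ => ?_
  have hsingle : ∀ (k : Fin N) (y : Time N), L.variation u v y (Pi.single k 1) =
      ∑ I ∈ multiIndicesLE N n, L.linCoeff u k I y * iterPderiv I v y := by
    intro k y
    rw [L.variation_apply, Finset.sum_eq_single k]
    · simp
    · intro l _ hl
      simp [hl]
    · simp
  rw [(hasDerivAt_graphCurve x j i hg s).deriv, map_add, map_smul, map_smul, hsingle, hsingle,
    smul_eq_mul, smul_eq_mul]

/-- The equations `δ_i L_i/δu_I = 0` for `i ∉ I`, from arcs that are segments in the `i`-th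
coordinate direction. -/
theorem LagrangianForm.eulerCoeff_eq_zero_of_isCriticalOn {L : LagrangianForm N n}
    {u : Time N → ℝ} (hu : ContDiff ℝ ∞ u)
    (hcrit : ∀ (p q : Time N) (γ : Path p q), IsSmoothArc γ → L.IsCriticalOn u γ)
    (i : Fin N) {I : MultiIndex N} (hI : I i = 0) (x : Time N) : L.eulerCoeff u i I x = 0 := by
  by_cases hn : n < order I
  · rw [L.eulerCoeff_eq_zero hu i hn]
    rfl
  set A := L.eulerCoeff u i I with hA
  have hAs : ContDiff ℝ ∞ A := L.contDiff_eulerCoeff hu i I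
  obtain ⟨χ, hχ, hχ1, hχ0, hχs⟩ := exists_bump (x i)
  choose φ₀ hφ₀ hδ _ using fun k : Fin N => exists_delta_jet (x k) (I k)
  -- Along the segment, the variation is `A χ`, and its normal derivatives of order `I` are
  -- normalised to `1`, so that the integrand becomes `A² χ`.
  set φi : ℝ → ℝ := fun y => A (Function.update x i y) * χ y with hφi
  have hφis : ContDiff ℝ ∞ φi := (hAs.comp (contDiff_update ∞ x i)).mul hχ
  set φ : Fin N → ℝ → ℝ := Function.update φ₀ i φi with hφ
  have hφs : ∀ k, ContDiff ℝ ∞ (φ k) := by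
    intro k
    rcases eq_or_ne k i with rfl | hk
    · simpa [hφ] using hφis
    · simpa [hφ, hk] using hφ₀ k
  set v : Time N → ℝ := fun y => ∏ k, φ k (y k) with hv
  have hvs : ContDiff ℝ ∞ v := contDiff_prod fun k _ => (hφs k).comp (contDiff_apply ℝ ℝ k)
  set c := graphCurve x i i 0 with hc
  have hcs : ContDiff ℝ ∞ c := contDiff_graphCurve x i i contDiff_const
  have hend : ∀ s : ℝ, 1 ≤ |2 * s - 1| → ∀ J : MultiIndex N, iterPderiv J v (c s) = 0 := by
    intro s hs J
    rw [hv, iterPderiv_prod hφs]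
    refine Finset.prod_eq_zero (Finset.mem_univ i) ?_
    rw [hφ, Function.update_self]
    refine iteratedDeriv_eq_zero_of_one_le_abs (a := x i)
      (fun y hy => by rw [hφi]; simp [hχs y hy]) _ ?_
    rw [hc, graphCurve_zero_apply_self, add_sub_cancel_left]
    exact hs
  have hcupd : ∀ s, Function.update x i (c s i) = c s := by
    intro s
    funext k
    rcases eq_or_ne k i with rfl | hk
    · simp
    · rw [Function.update_of_ne hk, hc, graphCurve_zero_apply_of_ne x hk]
  have hsum : ∀ s, (∑ J ∈ multiIndicesLE N n with J i = 0,
      L.eulerCoeff u i J (c s) * iterPderiv J v (c s)) = A (c s) ^ 2 * χ (c s i) := by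
    intro s
    rw [Finset.sum_eq_single I]
    · rw [hv, iterPderiv_prod hφs]
      dsimp only
      rw [Finset.prod_eq_single i]
      · rw [hI, iteratedDeriv_zero, hφ, Function.update_self, hφi]
        dsimp only
        rw [hcupd]
        ring
      · intro k _ hk
        rw [hφ, Function.update_of_ne hk, hc, graphCurve_zero_apply_of_ne x hk, hδ]
        simp
      · simp
    · intro J hJ hJI
      obtain ⟨k, hk⟩ := Function.ne_iff.1 hJI
      have hki : k ≠ i := by
        rintro rfl
        exact hk ((Finset.mem_filter.1 hJ).2.trans hI.symm)
      rw [hv, iterPderiv_prod hφs]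
      dsimp only
      rw [Finset.prod_eq_zero (Finset.mem_univ k), mul_zero]
      rw [hφ, Function.update_of_ne hki, hc, graphCurve_zero_apply_of_ne x hki, hδ, if_neg hk]
    · intro h
      exact absurd (Finset.mem_filter.2 ⟨mem_multiIndicesLE.2 (not_lt.1 hn), hI⟩) h
  have hB : ContDiff ℝ ∞ (L.boundaryTerm u v i) := L.contDiff_boundaryTerm hu hvs i
  have hderiv : ∀ s, HasDerivAt (fun s => L.boundaryTerm u v i (c s))
      (2 * pderiv i (L.boundaryTerm u v i) (c s)) s := fun s => by
    simpa using hasDerivAt_comp_graphCurve hB x i i (g := 0) contDiff_const s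
  have hcont1 : Continuous fun s => 2 * (A (c s) ^ 2 * χ (c s i)) :=
    continuous_const.mul (((hAs.continuous.comp hcs.continuous).pow 2).mul
      (hχ.continuous.comp ((continuous_apply i).comp hcs.continuous)))
  have hcont2 : Continuous fun s => 2 * pderiv i (L.boundaryTerm u v i) (c s) :=
    continuous_const.mul ((contDiff_pderiv hB i).continuous.comp hcs.continuous)
  have hint : ∫ s in (0 : ℝ)..1, 2 * (A (c s) ^ 2 * χ (c s i)) = 0 := by
    have key := L.integral_graphCurve_eq_zero hcrit hvs x (j := i) (i := i) (g := 0)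
      contDiff_const (graphCurve_zero_apply_self x i) (hend 0 (by norm_num))
      (hend 1 (by norm_num))
    have hrw : ∀ s, (2 * ∑ J ∈ multiIndicesLE N n, L.linCoeff u i J (c s) *
          iterPderiv J v (c s) + deriv (0 : ℝ → ℝ) s * ∑ J ∈ multiIndicesLE N n,
          L.linCoeff u i J (c s) * iterPderiv J v (c s)) =
        2 * (A (c s) ^ 2 * χ (c s i)) + 2 * pderiv i (L.boundaryTerm u v i) (c s) := by
      intro s
      rw [L.sum_linCoeff_mul hu hvs, hsum]
      simp
      ring
    rw [← hc] at key
    simp only [hrw] at key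
    rw [intervalIntegral.integral_add (hcont1.intervalIntegrable _ _)
      (hcont2.intervalIntegrable _ _), intervalIntegral.integral_eq_sub_of_hasDerivAt
      (fun s _ => hderiv s) (hcont2.intervalIntegrable _ _),
      L.boundaryTerm_eq_zero (hend 0 (by norm_num)),
      L.boundaryTerm_eq_zero (hend 1 (by norm_num)), sub_self, add_zero] at key
    exact key
  -- The integrand is nonnegative, and equals `2 A(x)²` at the midpoint `x` of the segment.
  by_contra hne
  refine (intervalIntegral.integral_pos one_pos hcont1.continuousOn (fun s _ =>
    mul_nonneg two_pos.le (mul_nonneg (sq_nonneg _) (hχ0 _)))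
    ⟨1 / 2, by norm_num, ?_⟩).ne' hint
  have hcx : c (1 / 2) = x := by
    simp [hc, graphCurve]
  rw [hcx, hχ1.self_of_nhds]
  positivity

/-- A function is zero at `x` if its derivative along `e_j` integrates to zero over all smooth
graphs `x + (2s - 1) e_j + g(s) e_i` and it vanishes far away: letting `g` tend to the step
function that jumps from `0` to `1` at `s = 1/2`, only the segment from `x - e_j` to `x`
contributes in the limit. -/
theorem eq_zero_of_integral_graphCurve_eq_zero {ψ : Time N → ℝ} (hψ : ContDiff ℝ ∞ ψ)
    {x : Time N} {j i : Fin N} (hij : i ≠ j)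
    (hfar : ∀ y : Time N, 1 ≤ |y i - x i| → pderiv j ψ y = 0)
    (hstart : ψ (x - Pi.single j 1) = 0)
    (hint : ∀ g : ℝ → ℝ, ContDiff ℝ ∞ g →
      ∫ s in (0 : ℝ)..1, pderiv j ψ (graphCurve x j i g s) = 0) : ψ x = 0 := by
  have hD : Continuous (pderiv j ψ) := (contDiff_pderiv hψ j).continuous
  -- `g k` is `0` for `s ≤ 1/2 - 1/k` and `1` for `s ≥ 1/2`.
  set g : ℕ → ℝ → ℝ := fun k s => 1 - Real.smoothTransition (k * (1 / 2 - s)) with hgdef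
  have hg : ∀ k, ContDiff ℝ ∞ (g k) := fun k =>
    contDiff_const.sub (Real.smoothTransition.contDiff.comp
      (contDiff_const.mul (contDiff_const.sub contDiff_id)))
  have hcont : ∀ k, Continuous fun s => pderiv j ψ (graphCurve x j i (g k) s) := fun k =>
    hD.comp (contDiff_graphCurve x j i (hg k)).continuous
  have hhalf : ∀ k, ∫ s in (0 : ℝ)..(1 / 2), pderiv j ψ (graphCurve x j i (g k) s) = 0 := by
    intro k
    have h := hint (g k) (hg k)
    rw [← intervalIntegral.integral_add_adjacent_intervals
      ((hcont k).intervalIntegrable 0 (1 / 2)) ((hcont k).intervalIntegrable (1 / 2) 1)] at h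
    have hzero : ∫ s in (1 / 2 : ℝ)..1, pderiv j ψ (graphCurve x j i (g k) s) = 0 := by
      rw [intervalIntegral.integral_congr (g := fun _ => (0 : ℝ)), intervalIntegral.integral_zero]
      intro s hs
      rw [Set.uIcc_of_le (by norm_num)] at hs
      refine hfar _ ?_
      rw [graphCurve_apply_snd x hij, hgdef]
      dsimp only
      rw [Real.smoothTransition.zero_of_nonpos
        (mul_nonpos_of_nonneg_of_nonpos k.cast_nonneg (by linarith [hs.1]))]
      simp
    rwa [hzero, add_zero] at h
  obtain ⟨C, hC⟩ : ∃ C, ∀ z ∈ Set.Icc (0 : ℝ) 1 ×ˢ Set.Icc (0 : ℝ) 1,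
      ‖pderiv j ψ (graphCurve x j i (fun _ => z.2) z.1)‖ ≤ C := by
    refine (isCompact_Icc.prod isCompact_Icc).exists_bound_of_continuousOn
      (hD.comp ?_).continuousOn
    unfold graphCurve
    fun_prop
  have hlim : Filter.Tendsto
      (fun k : ℕ => ∫ s in (0 : ℝ)..(1 / 2), pderiv j ψ (graphCurve x j i (g k) s))
      Filter.atTop (nhds (∫ s in (0 : ℝ)..(1 / 2), pderiv j ψ (graphCurve x j i 0 s))) := by
    refine intervalIntegral.tendsto_integral_filter_of_dominated_convergence (fun _ => C)
      (Filter.Eventually.of_forall fun k => (hcont k).aestronglyMeasurable)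
      (Filter.Eventually.of_forall fun k => Filter.Eventually.of_forall fun s hs => ?_)
      intervalIntegrable_const ?_
    · rw [Set.uIoc_of_le (by norm_num)] at hs
      refine hC (s, g k s) ⟨⟨hs.1.le, hs.2.trans (by norm_num)⟩, ?_, ?_⟩
      · exact sub_nonneg.2 (Real.smoothTransition.le_one _)
      · exact sub_le_self _ (Real.smoothTransition.nonneg _)
    · filter_upwards [MeasureTheory.Measure.ae_ne MeasureTheory.volume (1 / 2 : ℝ)] with s hne hs
      rw [Set.uIoc_of_le (by norm_num)] at hs
      have hlt : 0 < 1 / 2 - s := sub_pos.2 (lt_of_le_of_ne hs.2 hne)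
      refine tendsto_const_nhds.congr' ?_
      filter_upwards [(tendsto_natCast_atTop_atTop.atTop_mul_const hlt).eventually_ge_atTop
        (1 : ℝ)] with k hk
      have : g k s = 0 := by
        rw [hgdef]
        dsimp only
        rw [Real.smoothTransition.one_of_one_le hk, sub_self]
      simp [graphCurve, this]
  simp only [hhalf] at hlim
  have hzero := tendsto_nhds_unique hlim tendsto_const_nhds
  have hftc : ∫ s in (0 : ℝ)..(1 / 2), 2 * pderiv j ψ (graphCurve x j i 0 s) =
      ψ (graphCurve x j i 0 (1 / 2)) - ψ (graphCurve x j i 0 0) := by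
    refine intervalIntegral.integral_eq_sub_of_hasDerivAt (f := fun s => ψ (graphCurve x j i 0 s))
      (fun s _ => ?_) (Continuous.intervalIntegrable ?_ _ _)
    · simpa using hasDerivAt_comp_graphCurve hψ x j i (g := 0) contDiff_const s
    · exact continuous_const.mul
        (hD.comp (contDiff_graphCurve x j i (g := 0) contDiff_const).continuous)
  rw [intervalIntegral.integral_const_mul, hzero] at hftc
  have e1 : graphCurve x j i 0 (1 / 2) = x := by simp [graphCurve]
  have e2 : graphCurve x j i 0 0 = x - Pi.single j 1 := by
    simp [graphCurve, sub_eq_add_neg, ← Pi.single_neg]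
  rw [e1, e2, hstart] at hftc
  linarith

/-- The equations `δ_i L_i/δu_{Ii} = δ_j L_j/δu_{Ij}`, from arcs in the planes spanned by
the `i`-th and `j`-th coordinate directions. -/
theorem LagrangianForm.eulerCoeff_eq_of_isCriticalOn {L : LagrangianForm N n}
    {u : Time N → ℝ} (hu : ContDiff ℝ ∞ u)
    (hcrit : ∀ (p q : Time N) (γ : Path p q), IsSmoothArc γ → L.IsCriticalOn u γ)
    {i j : Fin N} (hij : i ≠ j) (I : MultiIndex N) (x : Time N) :
    L.eulerCoeff u i (incr I i 1) x = L.eulerCoeff u j (incr I j 1) x := by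
  by_cases hn : n < order I
  · rw [L.eulerCoeff_eq_zero hu i (by rw [order_incr]; omega),
      L.eulerCoeff_eq_zero hu j (by rw [order_incr]; omega)]
  -- The only nonzero derivative of the variation at `x` is the one with index `I`.
  choose φ hφs hδ hsupp using fun k : Fin N => exists_delta_jet (x k) (I k)
  set v : Time N → ℝ := fun y => ∏ k, φ k (y k) with hv
  have hvs : ContDiff ℝ ∞ v := contDiff_prod fun k _ => (hφs k).comp (contDiff_apply ℝ ℝ k)
  have hfar : ∀ (k : Fin N) (y : Time N), 1 ≤ |y k - x k| →
      ∀ J : MultiIndex N, iterPderiv J v y = 0 := by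
    intro k y hy J
    rw [hv, iterPderiv_prod hφs]
    exact Finset.prod_eq_zero (Finset.mem_univ k) (hsupp k _ _ hy)
  have hB : ∀ k, ContDiff ℝ ∞ (L.boundaryTerm u v k) := L.contDiff_boundaryTerm hu hvs
  have hBx : ∀ k, L.boundaryTerm u v k x = L.eulerCoeff u k (incr I k 1) x := by
    intro k
    rw [LagrangianForm.boundaryTerm, Finset.sum_eq_single I]
    · rw [hv, iterPderiv_prod hφs]
      simp [hδ]
    · intro J _ hJI
      obtain ⟨l, hl⟩ := Function.ne_iff.1 hJI
      rw [hv, iterPderiv_prod hφs]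
      dsimp only
      rw [Finset.prod_eq_zero (Finset.mem_univ l) (by rw [hδ, if_neg hl]), mul_zero]
    · intro h
      exact absurd (mem_multiIndicesLE.2 (not_lt.1 hn)) h
  have hpB : ∀ (k : Fin N) (y : Time N), 1 ≤ |y i - x i| →
      pderiv j (L.boundaryTerm u v k) y = 0 := by
    intro k y hy
    rw [L.pderiv_boundaryTerm hu hvs]
    exact Finset.sum_eq_zero fun J _ => by rw [hfar i y hy, hfar i y hy]; simp
  have hψ : ContDiff ℝ ∞ fun y => L.boundaryTerm u v j y - L.boundaryTerm u v i y :=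
    (hB j).sub (hB i)
  have hpψ := pderiv_sub (hB j) (hB i) j
  have hzero := eq_zero_of_integral_graphCurve_eq_zero hψ (x := x) hij ?_ ?_ ?_
  · rw [hBx, hBx] at hzero
    linarith
  · intro y hy
    rw [hpψ, hpB j y hy, hpB i y hy, sub_self]
  · have h := hfar j (x - Pi.single j 1) (by simp)
    rw [L.boundaryTerm_eq_zero h, L.boundaryTerm_eq_zero h, sub_self]
  · intro g hg
    set c := graphCurve x j i g with hc
    have hcs : ContDiff ℝ ∞ c := contDiff_graphCurve x j i hg
    have hend : ∀ s : ℝ, 1 ≤ |2 * s - 1| → ∀ J : MultiIndex N, iterPderiv J v (c s) = 0 := by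
      intro s hs
      refine hfar j _ ?_
      rw [hc, graphCurve_apply_fst x hij, add_sub_cancel_left]
      exact hs
    have h0 := hend 0 (by norm_num)
    have h1 := hend 1 (by norm_num)
    have key := L.integral_graphCurve_eq_zero hcrit hvs x hg (graphCurve_apply_fst x hij g)
      h0 h1
    rw [← hc] at key
    have hcoeff : ∀ (k : Fin N) (y : Time N),
        ∑ J ∈ multiIndicesLE N n, L.linCoeff u k J y * iterPderiv J v y =
          pderiv k (L.boundaryTerm u v k) y := by
      intro k y
      rw [L.sum_linCoeff_mul hu hvs, Finset.sum_eq_zero, zero_add]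
      intro J hJ
      rw [L.eulerCoeff_eq_zero_of_isCriticalOn hu hcrit k (Finset.mem_filter.1 hJ).2, zero_mul]
    -- Subtracting the total derivative of the `i`-th boundary term along the curve removes `g'`.
    have hrw : ∀ s, 2 * pderiv j (L.boundaryTerm u v j) (c s) +
        deriv g s * pderiv i (L.boundaryTerm u v i) (c s) =
        2 * pderiv j (fun y => L.boundaryTerm u v j y - L.boundaryTerm u v i y) (c s) +
        (2 * pderiv j (L.boundaryTerm u v i) (c s) +
          deriv g s * pderiv i (L.boundaryTerm u v i) (c s)) := by
      intro s
      rw [hpψ]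
      ring
    simp only [hcoeff, hrw] at key
    have hcomp : ∀ {f : Time N → ℝ} (k : Fin N), ContDiff ℝ ∞ f →
        Continuous fun s => pderiv k f (c s) := fun k hf =>
      (contDiff_pderiv hf k).continuous.comp hcs.continuous
    have hint1 : Continuous fun s =>
        2 * pderiv j (fun y => L.boundaryTerm u v j y - L.boundaryTerm u v i y) (c s) :=
      continuous_const.mul (hcomp j hψ)
    have hint2 : Continuous fun s => 2 * pderiv j (L.boundaryTerm u v i) (c s) +
        deriv g s * pderiv i (L.boundaryTerm u v i) (c s) :=
      (continuous_const.mul (hcomp j (hB i))).add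
        ((hg.continuous_deriv (by simp)).mul (hcomp i (hB i)))
    rw [intervalIntegral.integral_add (hint1.intervalIntegrable _ _)
      (hint2.intervalIntegrable _ _), intervalIntegral.integral_const_mul,
      intervalIntegral.integral_eq_sub_of_hasDerivAt
        (fun s _ => hasDerivAt_comp_graphCurve (hB i) x j i hg s)
        (hint2.intervalIntegrable _ _)] at key
    rw [← hc, L.boundaryTerm_eq_zero h0, L.boundaryTerm_eq_zero h1] at key
    linarith

theorem LagrangianForm.satisfiesEulerLagrange_of_isCriticalOn {L : LagrangianForm N n}
    {u : Time N → ℝ} (hu : ContDiff ℝ ∞ u)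
    (hcrit : ∀ (p q : Time N) (γ : Path p q), IsSmoothArc γ → L.IsCriticalOn u γ) :
    L.SatisfiesEulerLagrange u :=
  ⟨fun i _ hI x => L.eulerCoeff_eq_zero_of_isCriticalOn hu hcrit i hI x,
    fun _ _ hij I x => L.eulerCoeff_eq_of_isCriticalOn hu hcrit hij I x⟩

end MultiTime

theorem mainTheorem3 {N n : ℕ} (L : LagrangianForm N n) (u : Time N → ℝ)
    (hu : ContDiff ℝ ∞ u) :
    ((∀ (p q : Time N) (γ : Path p q), IsPiecewiseSmoothCurve γ → L.IsCriticalOn u γ) ↔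
      L.SatisfiesEulerLagrange u) ∧
    ((∀ (p q : Time N) (γ : Path p q), IsSmoothArc γ → L.IsCriticalOn u γ) ↔
      L.SatisfiesEulerLagrange u) :=
  ⟨⟨fun h => L.satisfiesEulerLagrange_of_isCriticalOn hu fun p q γ hγ =>
      h p q γ hγ.isPiecewiseSmoothCurve,
    fun h _ _ _ hγ => h.isCriticalOn hu hγ⟩,
  ⟨fun h => L.satisfiesEulerLagrange_of_isCriticalOn hu h,
    fun h _ _ _ hγ => h.isCriticalOn hu hγ.isPiecewiseSmoothCurve⟩⟩
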